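/- Let $n\ge 1$, let $\mathbb F_n^+$ be the free monoid on $n$ generators $g_1,\dots,g_n$ with identity $g_0$ (the empty word), and write $|\alpha|$ for the length of $\alpha\in\mathbb F_n^+$. For operators $T_1,\dots,T_n$ in the algebra $B(\mathcal K)$ of bounded operators on a complex Hilbert space $\mathcal K$ put $T_\alpha:=T_{i_1}\cdots T_{i_k}$ if $\alpha=g_{i_1}\cdots g_{i_k}$, and $T_{g_0}:=I_{\mathcal K}$. Tensor products of Hilbert spaces are Hilbert space tensor products. Let $\mathcal H$ be a complex Hilbert space and let $A_{(\alpha)}\in B(\mathcal H)$ for $\alpha\in\mathbb F_n^+$; write $A_{(0)}:=A_{(g_0)}$. Suppose that the series $$F(X_1,\dots,X_n):=\sum_{k=0}^\infty\sum_{|\alpha|=k}X_\alpha\otimes A_{(\alpha)}$$ defines a (universal) holomorphic function with coefficients in $B(\mathcal H)$, that is, its partial sums over $k$ converge in operator norm for every complex Hilbert space $\mathcal X$ and every $(X_1,\dots,X_n)\in B(\mathcal X)^n$ with $\|X_1X_1^*+\cdots+X_nX_n^*\|<1$. Suppose moreover that $F(0)\ge 0$ and that $$\operatorname{Re}F(X_1,\dots,X_n):=\tfrac12\bigl(F(X_1,\dots,X_n)+F(X_1,\dots,X_n)^*\bigr)\le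 I$$ for all such $\mathcal X$ and $(X_1,\dots,X_n)$. Then $$\sum_{k=0}^\infty\Bigl\|\sum_{|\alpha|=k}T_\alpha\otimes A_{(\alpha)}\Bigr\|\le\|A_{(0)}\|+\|I-A_{(0)}\|$$ (in particular, the series on the left converges) for every complex Hilbert space $\mathcal K$ and every $(T_1,\dots,T_n)\in B(\mathcal K)^n$ with $\|T_1T_1^*+\cdots+T_nT_n^*\|^{1/2}\le\frac13$. -/

import Mathlib

open Filter Topology
open scoped TensorProduct ComplexStarModule

universe u v w

/-- The Hilbert space tensor product of two complex Hilbert spaces: the completion of the algebraic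
tensor product for the inner product `⟪x ⊗ h, x' ⊗ h'⟫ = ⟪x, x'⟫ * ⟪h, h'⟫`. -/
abbrev HilbertTensor (X H : Type*) [NormedAddCommGroup X] [InnerProductSpace ℂ X]
    [NormedAddCommGroup H] [InnerProductSpace ℂ H] : Type _ :=
  UniformSpace.Completion (X ⊗[ℂ] H)

section Operators

variable {X H : Type*} [NormedAddCommGroup X] [InnerProductSpace ℂ X]
  [NormedAddCommGroup H] [InnerProductSpace ℂ H]

/-- The tensor product `T ⊗ A` of two bounded operators, acting on the Hilbert tensor product. -/
noncomputable def opTensor (T : X →L[ℂ] X) (A : H →L[ℂ] H) :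
    HilbertTensor X H →L[ℂ] HilbertTensor X H :=
  (TensorProduct.mapL T A).completion

theorem opTensor_tmul (T : X →L[ℂ] X) (A : H →L[ℂ] H) (x : X) (h : H) :
    opTensor T A ((x ⊗ₜ[ℂ] h : X ⊗[ℂ] H) : HilbertTensor X H) =
      ((T x ⊗ₜ[ℂ] A h : X ⊗[ℂ] H) : HilbertTensor X H) := by
  simp [opTensor]

/-- The word `T_α = T_{i₁} ⋯ T_{i_k}` in the operators `T₁, …, Tₙ` for `α = g_{i₁} ⋯ g_{i_k}` in the
free monoid on `n` generators; the empty word gives the identity. -/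
def wordOp {n : ℕ} (T : Fin n → (X →L[ℂ] X)) (α : FreeMonoid (Fin n)) : X →L[ℂ] X :=
  FreeMonoid.lift T α

/-- The homogeneous part `∑_{|α| = k} T_α ⊗ A_(α)`. The words of length `k` are enumerated by
their sequences of letters `Fin k → Fin n`. -/
noncomputable def homogPart {n : ℕ} (A : FreeMonoid (Fin n) → (H →L[ℂ] H))
    (T : Fin n → (X →L[ℂ] X)) (k : ℕ) : HilbertTensor X H →L[ℂ] HilbertTensor X H :=
  ∑ w : Fin k → Fin n,
    opTensor (wordOp T (FreeMonoid.ofList (List.ofFn w))) (A (FreeMonoid.ofList (List.ofFn w)))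

/-- The value `F(X₁, …, Xₙ) = ∑_{k ≥ 0} ∑_{|α| = k} X_α ⊗ A_(α)` of the power series with
coefficients `A`: the limit in operator norm of the partial sums over `k`
(a junk value where they do not converge). -/
noncomputable def seriesValue {n : ℕ} (A : FreeMonoid (Fin n) → (H →L[ℂ] H))
    (T : Fin n → (X →L[ℂ] X)) : HilbertTensor X H →L[ℂ] HilbertTensor X H :=
  limUnder atTop fun N : ℕ => ∑ k ∈ Finset.range N, homogPart A T k

/-- Membership in the open unit ball `[B(X)^n]_{<1}`: `‖X₁ X₁* + ⋯ + Xₙ Xₙ*‖ < 1`. -/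
def InOpenRowBall [CompleteSpace X] {n : ℕ} (T : Fin n → (X →L[ℂ] X)) : Prop :=
  ‖∑ i, T i * star (T i)‖ < 1

/-- Membership in the closed ball `[B(K)^n]_r`: `‖T₁ T₁* + ⋯ + Tₙ Tₙ*‖^{1/2} ≤ r`. -/
def InClosedRowBall [CompleteSpace X] {n : ℕ} (r : ℝ) (T : Fin n → (X →L[ℂ] X)) : Prop :=
  √‖∑ i, T i * star (T i)‖ ≤ r

end Operators

/-- The power series with coefficients `A` generates a (universal) holomorphic function on the open
unit balls `[B(X)^n]_{<1}`: its partial sums converge in operator norm at every point of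
`[B(X)^n]_{<1}`, for every complex Hilbert space `X` (in the universe `u`). -/
def IsUniversalHolomorphic {H : Type v} [NormedAddCommGroup H] [InnerProductSpace ℂ H]
    {n : ℕ} (A : FreeMonoid (Fin n) → (H →L[ℂ] H)) : Prop :=
  ∀ (X : Type u) [NormedAddCommGroup X] [InnerProductSpace ℂ X] [CompleteSpace X]
    (T : Fin n → (X →L[ℂ] X)), InOpenRowBall T →
    ∃ L : HilbertTensor X H →L[ℂ] HilbertTensor X H,
      Tendsto (fun N : ℕ => ∑ k ∈ Finset.range N, homogPart A T k) atTop (𝓝 L)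

/-! Write `F_k` for the homogeneous parts at `T`. Homogeneity makes `F(zT) = ∑ z^k F_k` a
one-variable power series, and `Re (I - F) ≥ 0` then forces a Carathéodory bound: `‖F_k‖ ≤ 2 ‖I -
A_(0)‖ r^k` for `k ≥ 1` on the row ball of radius `r`. At `r = 1/3`, `2 ∑_{k ≥ 1} 3^{-k} = 1`, so
these terms add up to at most `‖I - A_(0)‖`; the term `k = 0` gives `‖A_(0)‖`.

The Carathéodory bound (`norm_coeff_le_two_mul_of_re_nonneg`) comes from testing positivity on `x +
z^k y` and averaging over roots of unity. The hypotheses concern spaces in one universe and `K` may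
live in another; `norm_homogPart_le_of_forall` bridges this by compressing to finite-dimensional
subspaces, since one homogeneous part sees only finitely many words. -/

/-! ### Carathéodory's coefficient inequality -/

theorem IsPrimitiveRoot.sum_pow_pow {ω : ℂ} {N : ℕ} (hω : IsPrimitiveRoot ω N) (e : ℕ) :
    ∑ j ∈ Finset.range N, (ω ^ j) ^ e = if N ∣ e then (N : ℂ) else 0 := by
  simp_rw [fun j => pow_right_comm ω j e]
  split_ifs with h
  · simp [(hω.pow_eq_one_iff_dvd e).2 h]
  · have h1 : ω ^ e - 1 ≠ 0 := sub_ne_zero.2 fun h' => h ((hω.pow_eq_one_iff_dvd e).1 h')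
    have h2 := geom_sum_mul (ω ^ e) N
    rw [pow_right_comm, hω.pow_eq_one, one_pow, sub_self] at h2
    exact (mul_eq_zero.1 h2).resolve_right h1

section Caratheodory

variable {M : Type*} [NormedAddCommGroup M] [InnerProductSpace ℂ M]

/-- The average of an operator polynomial over roots of unity, tested on the rotating vectors
`x + z ^ k • y`, only sees the coefficients of degrees `0` and `k`. -/
theorem sum_inner_rotating_vector (G : ℕ → M →L[ℂ] M) (x y : M) {k D : ℕ} (hk : k ≠ 0)
    (hD : k < D) {ω : ℂ} (hω : IsPrimitiveRoot ω (D + k)) :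
    ∑ j ∈ Finset.range (D + k), inner ℂ (x + (ω ^ j) ^ k • y)
        ((∑ m ∈ Finset.range D, (ω ^ j) ^ m • G m) (x + (ω ^ j) ^ k • y)) =
      (D + k : ℕ) * (inner ℂ x (G 0 x) + inner ℂ y (G 0 y) + inner ℂ y (G k x)) := by
  have hnorm : ‖ω‖ = 1 := hω.norm'_eq_one (by omega)
  have hexp : ∀ j ∈ Finset.range (D + k), inner ℂ (x + (ω ^ j) ^ k • y)
      ((∑ m ∈ Finset.range D, (ω ^ j) ^ m • G m) (x + (ω ^ j) ^ k • y)) =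
      ∑ m ∈ Finset.range D, ((ω ^ j) ^ m * (inner ℂ x (G m x) + inner ℂ y (G m y)) +
        (ω ^ j) ^ (m + k) * inner ℂ x (G m y) + (ω ^ j) ^ (m + D) * inner ℂ y (G m x)) := by
    intro j _
    have hz : ‖ω ^ j‖ = 1 := by simp [hnorm]
    have hz1 : (ω ^ j) ^ (D + k) = 1 := by rw [pow_right_comm, hω.pow_eq_one, one_pow]
    generalize ω ^ j = z at hz hz1
    have hc : (starRingEnd ℂ) z * z = 1 := by
      rw [← Complex.normSq_eq_conj_mul_self, Complex.normSq_eq_norm_sq, hz]; simp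
    have hck : (starRingEnd ℂ) z ^ k * z ^ k = 1 := by rw [← mul_pow, hc, one_pow]
    -- As `z` is a root of unity of order dividing `D + k`, conjugates become positive powers and
    -- all exponents stay in `ℕ`.
    have hcD : (starRingEnd ℂ) z ^ k = z ^ D := by
      calc (starRingEnd ℂ) z ^ k = (starRingEnd ℂ) z ^ k * z ^ (D + k) := by rw [hz1, mul_one]
        _ = z ^ D * ((starRingEnd ℂ) z ^ k * z ^ k) := by ring
        _ = z ^ D := by rw [hck, mul_one]
    rw [sum_apply, inner_sum]
    refine Finset.sum_congr rfl fun m _ => ?_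
    simp only [smul_apply, map_add, map_smul, inner_add_left, inner_add_right,
      inner_smul_left, inner_smul_right, map_pow]
    rw [hcD] at hck ⊢
    linear_combination z ^ m * inner ℂ y (G m y) * hck
  rw [Finset.sum_congr rfl hexp, Finset.sum_comm]
  simp_rw [Finset.sum_add_distrib, ← Finset.sum_mul, hω.sum_pow_pow]
  -- For `m < D`, the modulus `D + k` divides `m` only at `m = 0`, never divides `m + k`, and
  -- divides `m + D` only at `m = k`.
  have h0 : ∀ m ∈ Finset.range D, (if D + k ∣ m then ((D + k : ℕ) : ℂ) else 0) =
      if m = 0 then ((D + k : ℕ) : ℂ) else 0 := by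
    intro m hm
    have := Finset.mem_range.1 hm
    refine if_congr ⟨fun h => Nat.eq_zero_of_dvd_of_lt h (by omega), fun h => by simp [h]⟩ rfl rfl
  have h1 : ∀ m ∈ Finset.range D, (if D + k ∣ m + k then ((D + k : ℕ) : ℂ) else 0) = 0 := by
    intro m hm
    have := Finset.mem_range.1 hm
    refine if_neg fun h => ?_
    have := Nat.le_of_dvd (by omega) h
    omega
  have h2 : ∀ m ∈ Finset.range D, (if D + k ∣ m + D then ((D + k : ℕ) : ℂ) else 0) =
      if m = k then ((D + k : ℕ) : ℂ) else 0 := by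
    intro m hm
    have := Finset.mem_range.1 hm
    refine if_congr ⟨fun h => ?_, fun h => by rw [h, add_comm]⟩ rfl rfl
    obtain ⟨c, hc⟩ := h
    have hc2 : c < 2 := by
      by_contra! h
      have := Nat.mul_le_mul_left (D + k) h
      omega
    interval_cases c <;> omega
  have hD0 : 0 < D := by omega
  rw [Finset.sum_congr rfl fun m hm => congrArg
      (· * (inner ℂ x (G m x) + inner ℂ y (G m y))) (h0 m hm),
    Finset.sum_congr rfl fun m hm => congrArg (· * inner ℂ x (G m y)) (h1 m hm),
    Finset.sum_congr rfl fun m hm => congrArg (· * inner ℂ y (G m x)) (h2 m hm)]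
  simp [ite_mul, hD, hD0]
  ring

/-- Carathéodory's coefficient inequality for operator-valued power series: if the real part of
`∑ zᵐ Gₘ` is nonnegative on the unit circle, then `‖G_k‖ ≤ 2 ‖G₀‖` for `k ≥ 1`. -/
theorem norm_coeff_le_two_mul_of_re_nonneg (G : ℕ → M →L[ℂ] M)
    (hG : Summable fun m => ‖G m‖) (L : ℂ → M →L[ℂ] M)
    (hL : ∀ z : ℂ, ‖z‖ = 1 → HasSum (fun m => z ^ m • G m) (L z))
    (hpos : ∀ z : ℂ, ‖z‖ = 1 → ∀ v, 0 ≤ (inner ℂ v (L z v)).re) {k : ℕ} (hk : k ≠ 0) :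
    ‖G k‖ ≤ 2 * ‖G 0‖ := by
  have key : ∀ x y : M, ‖x‖ = 1 → ‖y‖ = 1 → -(2 * ‖G 0‖) ≤ (inner ℂ y (G k x)).re := by
    intro x y hx hy
    refine le_of_forall_pos_le_add fun ε hε => ?_
    have htail := tendsto_sum_nat_add fun m => ‖G m‖
    -- The test vectors have norm at most `2`, so a tail below `ε / 4` changes the quadratic form by
    -- at most `ε`.
    obtain ⟨D, hDε, hDk⟩ := ((htail.eventually_lt_const (show (0 : ℝ) < ε / 4 by positivity)).and
      (eventually_gt_atTop k)).exists
    have hlow : ∀ z : ℂ, ‖z‖ = 1 →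
        -ε ≤ (inner ℂ (x + z ^ k • y)
          ((∑ m ∈ Finset.range D, z ^ m • G m) (x + z ^ k • y))).re := by
      intro z hz
      set v := x + z ^ k • y
      have hv : ‖v‖ ≤ 2 := (norm_add_le _ _).trans
        (by rw [norm_smul, norm_pow, hz, hx, hy]; norm_num)
      have hterm : ∀ m, ‖z ^ m • G m‖ = ‖G m‖ := fun m => by rw [norm_smul, norm_pow, hz]; simp
      have hdiff : ‖L z - ∑ m ∈ Finset.range D, z ^ m • G m‖ ≤ ε / 4 := by
        have h1 : HasSum (fun m => z ^ (m + D) • G (m + D))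
            (L z - ∑ m ∈ Finset.range D, z ^ m • G m) :=
          (hasSum_nat_add_iff' D).2 (hL z hz)
        have h2 : Summable fun m => ‖G (m + D)‖ := (summable_nat_add_iff D).2 hG
        rw [← h1.tsum_eq]
        refine (tsum_of_norm_bounded h2.hasSum fun m => (hterm _).le).trans hDε.le
      have h3 := hpos z hz v
      have h4 : ‖inner ℂ v ((L z - ∑ m ∈ Finset.range D, z ^ m • G m) v)‖ ≤ ε := by
        calc _ ≤ ‖v‖ * (‖L z - ∑ m ∈ Finset.range D, z ^ m • G m‖ * ‖v‖) :=
              (norm_inner_le_norm _ _).trans (by gcongr; exact ContinuousLinearMap.le_opNorm _ _)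
          _ ≤ 2 * (ε / 4 * 2) := by gcongr
          _ = ε := by ring
      have h5 := (Complex.re_le_norm _).trans h4
      rw [sub_apply, inner_sub_right, Complex.sub_re] at h5
      linarith
    have hN : D + k ≠ 0 := by omega
    obtain ⟨ω, hω⟩ : ∃ ω : ℂ, IsPrimitiveRoot ω (D + k) :=
      ⟨_, Complex.isPrimitiveRoot_exp (D + k) hN⟩
    have hsum := congrArg Complex.re (sum_inner_rotating_vector G x y hk hDk hω)
    rw [Complex.re_sum, ← Complex.ofReal_natCast, Complex.re_ofReal_mul] at hsum
    have hge := Finset.card_nsmul_le_sum (Finset.range (D + k)) _ (-ε) fun j _ =>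
      hlow (ω ^ j)
        (by rw [norm_pow, hω.norm'_eq_one hN, one_pow])
    rw [hsum, Finset.card_range, nsmul_eq_mul] at hge
    have hav := le_of_mul_le_mul_left hge (by positivity)
    have hz : ∀ u : M, ‖u‖ = 1 → (inner ℂ u (G 0 u)).re ≤ ‖G 0‖ := fun u hu =>
      (Complex.re_le_norm _).trans <| (norm_inner_le_norm _ _).trans <| by
        rw [hu, one_mul]; exact (G 0).le_of_opNorm_le le_rfl u |>.trans (by rw [hu, mul_one])
    have := hz x hx
    have := hz y hy
    simp only [Complex.add_re] at hav
    linarith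
  refine ContinuousLinearMap.opNorm_le_of_re_inner_le (by positivity) fun x y hx hy => ?_
  -- Replacing `y` by `-y` turns the lower bound into an upper bound.
  have := key x (-y) hx (by rw [norm_neg, hy])
  rw [inner_neg_left, Complex.neg_re, ← inner_conj_symm, Complex.conj_re] at this
  exact neg_le_neg_iff.1 this

end Caratheodory

/-! ### Homogeneous parts on the Hilbert tensor product -/

section HomogeneousParts

variable {X H : Type*} [NormedAddCommGroup X] [InnerProductSpace ℂ X]
  [NormedAddCommGroup H] [InnerProductSpace ℂ H]

theorem opTensor_coe (T : X →L[ℂ] X) (A : H →L[ℂ] H) (t : X ⊗[ℂ] H) :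
    opTensor T A (t : HilbertTensor X H) =
      ((TensorProduct.map T.toLinearMap A.toLinearMap t : X ⊗[ℂ] H) : HilbertTensor X H) := by
  simp [opTensor]

theorem HilbertTensor.clm_ext {S T : HilbertTensor X H →L[ℂ] HilbertTensor X H}
    (h : ∀ t : X ⊗[ℂ] H, S (t : HilbertTensor X H) = T (t : HilbertTensor X H)) : S = T :=
  DFunLike.coe_injective <| UniformSpace.Completion.ext S.continuous T.continuous h

theorem HilbertTensor.opNorm_le {S : HilbertTensor X H →L[ℂ] HilbertTensor X H} {C : ℝ}
    (hC : 0 ≤ C) (h : ∀ t : X ⊗[ℂ] H, ‖S (t : HilbertTensor X H)‖ ≤ C * ‖t‖) : ‖S‖ ≤ C := by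
  refine S.opNorm_le_bound hC fun x => ?_
  induction x using UniformSpace.Completion.induction_on with
  | hp => exact isClosed_le (by fun_prop) (by fun_prop)
  | ih t => simpa using h t

theorem norm_opTensor_le (T : X →L[ℂ] X) (A : H →L[ℂ] H) : ‖opTensor T A‖ ≤ ‖T‖ * ‖A‖ := by
  refine HilbertTensor.opNorm_le (by positivity) fun t => ?_
  rw [opTensor_coe, UniformSpace.Completion.norm_coe, ← TensorProduct.mapL_apply]
  exact ContinuousLinearMap.le_of_opNorm_le _ (TensorProduct.norm_mapL_le T A) t

theorem norm_opTensor_one_le (A : H →L[ℂ] H) :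
    ‖opTensor (1 : X →L[ℂ] X) A‖ ≤ ‖A‖ :=
  (norm_opTensor_le _ _).trans <|
    mul_le_of_le_one_left (norm_nonneg _) ContinuousLinearMap.norm_id_le

theorem opTensor_smul_left (c : ℂ) (T : X →L[ℂ] X) (A : H →L[ℂ] H) :
    opTensor (c • T) A = c • opTensor T A := by
  refine HilbertTensor.clm_ext fun t => ?_
  rw [smul_apply, opTensor_coe, opTensor_coe, ContinuousLinearMap.toLinearMap_smul,
    TensorProduct.map_smul_left, LinearMap.smul_apply, UniformSpace.Completion.coe_smul]

theorem one_sub_opTensor_one (A : H →L[ℂ] H) :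
    1 - opTensor (1 : X →L[ℂ] X) A = opTensor 1 (1 - A) := by
  refine HilbertTensor.clm_ext fun t => ?_
  rw [sub_apply, opTensor_coe, opTensor_coe, one_apply_eq_self,
    ← UniformSpace.Completion.coe_sub]
  congr 1
  induction t with
  | zero => simp
  | tmul x h => simp [TensorProduct.tmul_sub]
  | add s t hs ht => rw [map_add, map_add, ← hs, ← ht]; abel

variable {n : ℕ}

theorem wordOp_ofList (T : Fin n → (X →L[ℂ] X)) (l : List (Fin n)) :
    wordOp T (FreeMonoid.ofList l) = (l.map T).prod :=
  FreeMonoid.lift_ofList _ _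

theorem wordOp_smul (c : ℂ) (T : Fin n → (X →L[ℂ] X)) (l : List (Fin n)) :
    wordOp (c • T) (FreeMonoid.ofList l) = c ^ l.length • wordOp T (FreeMonoid.ofList l) := by
  simp only [wordOp_ofList]
  induction l with
  | nil => simp
  | cons i l ih => simp [ih, pow_succ', smul_smul, mul_comm]

theorem homogPart_smul (A : FreeMonoid (Fin n) → (H →L[ℂ] H)) (c : ℂ)
    (T : Fin n → (X →L[ℂ] X)) (k : ℕ) : homogPart A (c • T) k = c ^ k • homogPart A T k := by
  simp only [homogPart, Finset.smul_sum]
  refine Finset.sum_congr rfl fun w _ => ?_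
  rw [wordOp_smul, List.length_ofFn, opTensor_smul_left]

theorem homogPart_zero (A : FreeMonoid (Fin n) → (H →L[ℂ] H)) (T : Fin n → (X →L[ℂ] X)) :
    homogPart A T 0 = opTensor 1 (A 1) := by
  simp [homogPart, wordOp]

theorem homogPart_coe (A : FreeMonoid (Fin n) → (H →L[ℂ] H)) (T : Fin n → (X →L[ℂ] X)) (k : ℕ)
    (t : X ⊗[ℂ] H) : homogPart A T k (t : HilbertTensor X H) =
      ((∑ w : Fin k → Fin n,
        TensorProduct.map (wordOp T (FreeMonoid.ofList (List.ofFn w))).toLinearMap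
          (A (FreeMonoid.ofList (List.ofFn w))).toLinearMap t : X ⊗[ℂ] H) :
        HilbertTensor X H) := by
  rw [homogPart, sum_apply]
  simp_rw [opTensor_coe]
  exact (map_sum (UniformSpace.Completion.toComplL (𝕜 := ℂ) (E := X ⊗[ℂ] H)) _ _).symm

theorem norm_row_smul [CompleteSpace X] (c : ℂ) (T : Fin n → (X →L[ℂ] X)) :
    ‖∑ i, (c • T) i * star ((c • T) i)‖ = ‖c‖ ^ 2 * ‖∑ i, T i * star (T i)‖ := by
  have : ∑ i, (c • T) i * star ((c • T) i) = (c * star c) • ∑ i, T i * star (T i) := by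
    rw [Finset.smul_sum]
    refine Finset.sum_congr rfl fun i _ => ?_
    rw [Pi.smul_apply, star_smul, smul_mul_smul_comm]
  rw [this, norm_smul, norm_mul, norm_star, sq]

end HomogeneousParts

/-! ### Coefficient estimates on the row ball -/

theorem re_inner_realPart {M : Type*} [NormedAddCommGroup M] [InnerProductSpace ℂ M]
    [CompleteSpace M] (S : M →L[ℂ] M) (v : M) :
    (inner ℂ v ((ℜ S : M →L[ℂ] M) v)).re = (inner ℂ v (S v)).re := by
  have h : inner ℂ v (star S v) = (starRingEnd ℂ) (inner ℂ v (S v)) := by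
    rw [ContinuousLinearMap.star_eq_adjoint, ContinuousLinearMap.adjoint_inner_right,
      inner_conj_symm]
  rw [realPart_apply_coe, smul_apply, add_apply, ← Complex.coe_smul, inner_smul_right,
    inner_add_right, h, Complex.re_ofReal_mul, Complex.add_re, Complex.conj_re]
  ring

/-- If a power series converges at a point of modulus greater than `1`, its coefficients are
absolutely summable. -/
theorem summable_norm_of_tendsto_sum_pow_smul {V : Type*} [NormedAddCommGroup V] [NormedSpace ℂ V]
    (g : ℕ → V) {c : ℂ} (hc : 1 < ‖c‖) {L : V}
    (hL : Tendsto (fun N => ∑ m ∈ Finset.range N, c ^ m • g m) atTop (𝓝 L)) :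
    Summable fun m => ‖g m‖ := by
  have h0 : Tendsto (fun m => c ^ m • g m) atTop (𝓝 0) := by
    have := ((tendsto_add_atTop_iff_nat 1).2 hL).sub hL
    simpa [Finset.sum_range_succ] using this
  obtain ⟨C, hC⟩ := h0.norm.bddAbove_range
  have hc0 : 0 < ‖c‖ := one_pos.trans hc
  have hgeom : Summable fun m : ℕ => C * ‖c‖⁻¹ ^ m :=
    (summable_geometric_of_lt_one (by positivity) (inv_lt_one_of_one_lt₀ hc)).mul_left C
  refine hgeom.of_nonneg_of_le (fun _ => norm_nonneg _) fun m => ?_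
  have h1 : ‖c ^ m • g m‖ ≤ C := hC ⟨m, rfl⟩
  rw [norm_smul, norm_pow] at h1
  rw [inv_pow, ← div_eq_mul_inv, le_div_iff₀ (by positivity), mul_comm]
  exact h1

theorem ContinuousLinearMap.norm_pow_smul {M : Type*} [NormedAddCommGroup M] [NormedSpace ℂ M]
    (c : ℂ) (k : ℕ) (S : M →L[ℂ] M) : ‖c ^ k • S‖ = ‖c‖ ^ k * ‖S‖ := by
  rw [norm_smul, norm_pow]

theorem ContinuousLinearMap.summable_norm_of_tendsto_sum_pow_smul {M : Type*}
    [NormedAddCommGroup M] [NormedSpace ℂ M] (g : ℕ → M →L[ℂ] M) {c : ℂ} (hc : 1 < ‖c‖)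
    {L : M →L[ℂ] M}
    (hL : Tendsto (fun N => ∑ m ∈ Finset.range N, c ^ m • g m) atTop (𝓝 L)) :
    Summable fun m => ‖g m‖ :=
  _root_.summable_norm_of_tendsto_sum_pow_smul g hc hL

/-- The coefficient inequality for operator-valued power series with real part at most `1`. -/
theorem norm_coeff_le_of_realPart_le_one {M : Type*} [NormedAddCommGroup M]
    [InnerProductSpace ℂ M] [CompleteSpace M] (g : ℕ → M →L[ℂ] M)
    (hg : Summable fun m => ‖g m‖)
    (hre : ∀ z : ℂ, ‖z‖ = 1 →
      (ℜ (limUnder atTop fun N => ∑ m ∈ Finset.range N, z ^ m • g m) : M →L[ℂ] M) ≤ 1)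
    {k : ℕ} (hk : k ≠ 0) :
    ‖g k‖ ≤ 2 * ‖1 - g 0‖ := by
  -- Coefficients of `1 - ∑ z^m g m`: the identity enters in degree `0` only, so `‖G k‖ = ‖g k‖` for
  -- `k ≠ 0`.
  set G : ℕ → M →L[ℂ] M := fun m => (if m = 0 then 1 else 0) - g m with hG
  have hone : ∀ z : ℂ, HasSum (fun m => z ^ m • (if m = 0 then (1 : M →L[ℂ] M) else 0)) 1 := by
    intro z
    convert hasSum_ite_eq 0 (1 : M →L[ℂ] M) using 2 with m
    split_ifs with h <;> simp [h]
  have hval : ∀ z : ℂ, ‖z‖ = 1 → HasSum (fun m => z ^ m • g m) (∑' m, z ^ m • g m) := by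
    intro z hz
    refine (Summable.of_norm ?_).hasSum
    simpa [norm_smul, hz] using hg
  have hGnorm : Summable fun m => ‖G m‖ := by
    rw [← summable_nat_add_iff 1]
    simpa [hG] using (summable_nat_add_iff 1).2 hg
  have := norm_coeff_le_two_mul_of_re_nonneg G hGnorm (fun z => 1 - ∑' m, z ^ m • g m)
    (fun z hz => by simpa only [hG, smul_sub] using (hone z).sub (hval z hz))
    (fun z hz x => by
      have h1 := hre z hz
      rw [(hval z hz).tendsto_sum_nat.limUnder_eq] at h1
      have h2 := ((ContinuousLinearMap.le_def _ _).1 h1).re_inner_nonneg_right x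
      rw [sub_apply, inner_sub_right, map_sub] at h2
      rw [sub_apply, inner_sub_right, Complex.sub_re,
        ← re_inner_realPart (∑' m, z ^ m • g m)]
      exact h2) hk
  simpa [hG, hk] using this

/-- The Cauchy-type estimate for the homogeneous parts of a universal holomorphic function whose
real part is at most `1`, at points of the universe in which the function is defined. -/
theorem norm_homogPart_le_of_re_le_one {H : Type v} [NormedAddCommGroup H] [InnerProductSpace ℂ H]
    {n : ℕ} (A : FreeMonoid (Fin n) → (H →L[ℂ] H))
    (hF : IsUniversalHolomorphic.{u, v} A)
    (hF_re : ∀ (X : Type u) [NormedAddCommGroup X] [InnerProductSpace ℂ X] [CompleteSpace X]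
      (T : Fin n → (X →L[ℂ] X)), InOpenRowBall T →
        (ℜ (seriesValue A T) : HilbertTensor X H →L[ℂ] HilbertTensor X H) ≤ 1)
    {X : Type u} [NormedAddCommGroup X] [InnerProductSpace ℂ X] [CompleteSpace X]
    (T : Fin n → (X →L[ℂ] X)) {r : ℝ} (hr : 0 ≤ r) (hT : InClosedRowBall r T) {k : ℕ}
    (hk : k ≠ 0) : ‖homogPart A T k‖ ≤ 2 * ‖1 - A 1‖ * r ^ k := by
  have hT2 : ‖∑ i, T i * star (T i)‖ ≤ r ^ 2 := (Real.sqrt_le_left hr).1 hT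
  have hball : ∀ c : ℂ, ‖c‖ * r < 1 → InOpenRowBall (c • T) := by
    intro c hc
    rw [InOpenRowBall, norm_row_smul]
    calc _ ≤ ‖c‖ ^ 2 * r ^ 2 := by gcongr
      _ = (‖c‖ * r) ^ 2 := by ring
      _ < 1 := by
        have : 0 ≤ ‖c‖ * r := by positivity
        nlinarith
  -- The hypotheses hold on the open ball only. For `s > r` the circle `z • (T / s)` lies inside it;
  -- `s → r` follows at the end, which also covers `r = 0`.
  have main : ∀ s, r < s → ‖homogPart A T k‖ ≤ 2 * ‖1 - A 1‖ * s ^ k := by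
    intro s hs
    have hs0 : 0 < s := hr.trans_lt hs
    obtain ⟨q, hrq, hqs⟩ := exists_between hs
    have hq0 : 0 < q := hr.trans_lt hrq
    set Y : Fin n → (X →L[ℂ] X) := ((s⁻¹ : ℝ) : ℂ) • T with hY
    have hnc : ∀ a : ℝ, 0 < a → ‖((a⁻¹ : ℝ) : ℂ)‖ = a⁻¹ := fun a ha => by
      rw [Complex.norm_real, Real.norm_of_nonneg (by positivity)]
    have hYball : ∀ z : ℂ, ‖z‖ = 1 → InOpenRowBall (z • Y) := by
      intro z hz
      rw [hY, smul_smul]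
      refine hball _ ?_
      rw [norm_mul, hz, hnc s hs0, one_mul, inv_mul_lt_one₀ hs0]
      exact hs
    -- Convergence at `T / q = (s / q) • Y`, with `s / q > 1`, gives absolute summability at `Y`.
    have hsum : Summable fun m => ‖homogPart A Y m‖ := by
      obtain ⟨L, hL⟩ := hF X (((q⁻¹ : ℝ) : ℂ) • T)
        (hball _ (by rw [hnc q hq0, inv_mul_lt_one₀ hq0]; exact hrq))
      have hYq : ((q⁻¹ : ℝ) : ℂ) • T = ((s / q : ℝ) : ℂ) • Y := by
        rw [hY, smul_smul, ← Complex.ofReal_mul]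
        congr 2
        field_simp
      simp only [hYq, homogPart_smul] at hL
      refine ContinuousLinearMap.summable_norm_of_tendsto_sum_pow_smul (homogPart A Y) ?_ hL
      rw [Complex.norm_real, Real.norm_of_nonneg (by positivity)]
      exact (one_lt_div hq0).2 hqs
    have hre : ∀ z : ℂ, ‖z‖ = 1 →
        (ℜ (limUnder atTop fun N => ∑ m ∈ Finset.range N, z ^ m • homogPart A Y m) :
          HilbertTensor X H →L[ℂ] HilbertTensor X H) ≤ 1 := by
      intro z hz
      simpa only [seriesValue, homogPart_smul] using hF_re X (z • Y) (hYball z hz)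
    have hGk' : ‖homogPart A Y k‖ ≤ 2 * ‖1 - A 1‖ := by
      refine (norm_coeff_le_of_realPart_le_one _ hsum hre hk).trans ?_
      rw [homogPart_zero, one_sub_opTensor_one]
      exact mul_le_mul_of_nonneg_left (norm_opTensor_one_le _) zero_le_two
    have hTY : T = ((s : ℝ) : ℂ) • Y := by
      rw [hY, smul_smul, ← Complex.ofReal_mul, mul_inv_cancel₀ hs0.ne', Complex.ofReal_one,
        one_smul]
    rw [hTY, homogPart_smul, ContinuousLinearMap.norm_pow_smul, Complex.norm_real,
      Real.norm_of_nonneg hs0.le, mul_comm]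
    gcongr
  have hcont : Tendsto (fun s : ℝ => 2 * ‖1 - A 1‖ * s ^ k) (𝓝[>] r)
      (𝓝 (2 * ‖1 - A 1‖ * r ^ k)) :=
    (Continuous.tendsto (by fun_prop) r).mono_left nhdsWithin_le_nhds
  exact ge_of_tendsto hcont (eventually_mem_nhdsWithin.mono fun s hs => main s hs)

/-! ### Compression and change of universe -/

section Compression

variable {K E : Type*} [NormedAddCommGroup K] [InnerProductSpace ℂ K] [CompleteSpace K]
  [NormedAddCommGroup E] [InnerProductSpace ℂ E] [CompleteSpace E]

/-- The compression `V* T V` of an operator along an isometry `V`. -/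
noncomputable def compression (V : E →ₗᵢ[ℂ] K) (T : K →L[ℂ] K) : E →L[ℂ] E :=
  V.toContinuousLinearMap.adjoint ∘L T ∘L V.toContinuousLinearMap

theorem LinearIsometry.adjoint_apply_self (V : E →ₗᵢ[ℂ] K) (y : E) :
    V.toContinuousLinearMap.adjoint (V y) = y := by
  refine ext_inner_left ℂ fun z => ?_
  rw [ContinuousLinearMap.adjoint_inner_right]
  exact V.inner_map_map z y

theorem LinearIsometry.apply_adjoint_of_mem_range (V : E →ₗᵢ[ℂ] K) {x : K} (hx : x ∈ Set.range V) :
    V (V.toContinuousLinearMap.adjoint x) = x := by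
  obtain ⟨y, rfl⟩ := hx
  rw [V.adjoint_apply_self]

theorem LinearIsometry.norm_toContinuousLinearMap_adjoint_le (V : E →ₗᵢ[ℂ] K) (x : K) :
    ‖V.toContinuousLinearMap.adjoint x‖ ≤ ‖x‖ := by
  refine (ContinuousLinearMap.le_of_opNorm_le _ (c := 1) ?_ x).trans_eq (one_mul _)
  rw [LinearIsometryEquiv.norm_map]
  exact V.norm_toContinuousLinearMap_le

variable {n : ℕ}

theorem re_inner_row (T : Fin n → (K →L[ℂ] K)) (x : K) :
    (inner ℂ x ((∑ i, T i * star (T i)) x)).re = ∑ i, ‖star (T i) x‖ ^ 2 := by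
  rw [sum_apply, inner_sum, Complex.re_sum]
  refine Finset.sum_congr rfl fun i _ => ?_
  rw [mul_apply_eq_comp, ContinuousLinearMap.star_eq_adjoint,
    ← ContinuousLinearMap.adjoint_inner_left]
  exact inner_self_eq_norm_sq (𝕜 := ℂ) _

/-- Positivity of `∑ T_i T_i*` reduces its norm to its quadratic form. The resulting condition on
the adjoints passes directly to compressions, where `(V* T V)* = V* T* V` and `V*` is contractive.
-/
theorem norm_row_le_iff (T : Fin n → (K →L[ℂ] K)) {c : ℝ} (hc : 0 ≤ c) :
    ‖∑ i, T i * star (T i)‖ ≤ c ↔ ∀ x, ∑ i, ‖star (T i) x‖ ^ 2 ≤ c * ‖x‖ ^ 2 := by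
  have hpos : (∑ i, T i * star (T i)).IsPositive :=
    (ContinuousLinearMap.nonneg_iff_isPositive _).1
      (Finset.sum_nonneg fun i _ => mul_star_self_nonneg (T i))
  constructor
  · intro h x
    rw [← re_inner_row]
    refine (Complex.re_le_norm _).trans ((norm_inner_le_norm _ _).trans ?_)
    calc _ ≤ ‖x‖ * (c * ‖x‖) := by
          gcongr
          exact ContinuousLinearMap.le_of_opNorm_le _ h x
      _ = _ := by ring
  · intro h
    have h1 : ∑ i, T i * star (T i) ≤ algebraMap ℝ (K →L[ℂ] K) c := by
      rw [ContinuousLinearMap.le_def, ContinuousLinearMap.isPositive_def']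
      refine ⟨(IsSelfAdjoint.algebraMap _ (IsSelfAdjoint.all c)).sub hpos.isSelfAdjoint,
        fun x => ?_⟩
      rw [ContinuousLinearMap.reApplyInnerSelf_apply, ← inner_re_symm, sub_apply, inner_sub_right,
        map_sub, sub_nonneg]
      have h2 := h x
      rw [← re_inner_row] at h2
      refine h2.trans_eq ?_
      rw [Algebra.algebraMap_eq_smul_one, smul_apply, one_apply_eq_self,
        ← Complex.coe_smul, inner_smul_right, inner_self_eq_norm_sq_to_K]
      change _ = Complex.re _
      rw [Complex.re_ofReal_mul]
      norm_cast
    refine (CStarAlgebra.norm_le_norm_of_nonneg_of_le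
      ((ContinuousLinearMap.nonneg_iff_isPositive _).2 hpos) h1).trans ?_
    rw [Algebra.algebraMap_eq_smul_one, norm_smul, Real.norm_of_nonneg hc]
    exact mul_le_of_le_one_right hc ContinuousLinearMap.norm_id_le

theorem InClosedRowBall.compression {r : ℝ} (hr : 0 ≤ r) {T : Fin n → (K →L[ℂ] K)}
    (hT : InClosedRowBall r T) (V : E →ₗᵢ[ℂ] K) :
    InClosedRowBall r fun i => compression V (T i) := by
  rw [InClosedRowBall, Real.sqrt_le_left hr, norm_row_le_iff _ (by positivity)] at hT ⊢
  intro y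
  calc _ ≤ ∑ i, ‖star (T i) (V y)‖ ^ 2 := by
        refine Finset.sum_le_sum fun i _ => ?_
        gcongr
        rw [ContinuousLinearMap.star_eq_adjoint, _root_.compression,
          ContinuousLinearMap.adjoint_comp, ContinuousLinearMap.adjoint_comp,
          ContinuousLinearMap.adjoint_adjoint]
        exact V.norm_toContinuousLinearMap_adjoint_le _
    _ ≤ _ := by simpa using hT (V y)

/-- Compressing to a subspace which contains the orbit of `x` under words of length at most `k`
does not change the action of these words on `x`. -/
theorem apply_wordOp_compression (V : E →ₗᵢ[ℂ] K) (T : Fin n → (K →L[ℂ] K)) (x : K) {k : ℕ}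
    (hx : ∀ l : List (Fin n), l.length ≤ k → wordOp T (FreeMonoid.ofList l) x ∈ Set.range V)
    (l : List (Fin n)) (hl : l.length ≤ k) :
    V (wordOp (fun i => compression V (T i)) (FreeMonoid.ofList l)
      (V.toContinuousLinearMap.adjoint x)) = wordOp T (FreeMonoid.ofList l) x := by
  induction l with
  | nil =>
    have := hx [] (Nat.zero_le _)
    simp only [wordOp_ofList, List.map_nil, List.prod_nil, one_apply_eq_self] at this ⊢
    exact V.apply_adjoint_of_mem_range this
  | cons i l ih =>
    have hi := ih ((Nat.le_succ _).trans hl)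
    have hmem := hx (i :: l) hl
    simp only [wordOp_ofList, List.map_cons, List.prod_cons, mul_apply_eq_comp] at hi hmem ⊢
    -- `V V*` fixes the range of `V`, which contains the vector for the longer word, so compressing
    -- the leftmost letter loses nothing.
    rw [compression, ContinuousLinearMap.comp_apply, ContinuousLinearMap.comp_apply,
      LinearIsometry.coe_toContinuousLinearMap, hi]
    exact V.apply_adjoint_of_mem_range hmem

end Compression

/-- Finitely many vectors lie, with their orbits under words of bounded length, in the range of an
isometry from a Hilbert space in any given universe. -/
theorem exists_isometry_orbit_subset_range {K : Type w} [NormedAddCommGroup K]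
    [InnerProductSpace ℂ K] {n : ℕ} (T : Fin n → (K →L[ℂ] K)) {s : Set K}
    (hs : s.Finite) (k : ℕ) :
    ∃ (d : ℕ) (V : EuclideanSpace ℂ (ULift.{u} (Fin d)) →ₗᵢ[ℂ] K), ∀ x ∈ s,
      ∀ l : List (Fin n), l.length ≤ k → wordOp T (FreeMonoid.ofList l) x ∈ Set.range V := by
  set S : Set K := Set.image2 (fun (l : List (Fin n)) x => wordOp T (FreeMonoid.ofList l) x)
    {l | l.length ≤ k} s with hS
  have hfin : S.Finite := (List.finite_length_le (Fin n) k).image2 _ hs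
  set W := Submodule.span ℂ S
  have : FiniteDimensional ℂ W := FiniteDimensional.span_of_finite ℂ hfin
  -- Indexing the basis by a `ULift` puts the coordinate space in universe `u`.
  let b := (stdOrthonormalBasis ℂ W).reindex Equiv.ulift.{u}.symm
  refine ⟨_, W.subtypeₗᵢ.comp b.repr.symm.toLinearIsometry, fun x hx l hl => ?_⟩
  have hmem : wordOp T (FreeMonoid.ofList l) x ∈ W :=
    Submodule.subset_span ⟨l, hl, x, hx, rfl⟩
  exact ⟨b.repr ⟨_, hmem⟩, by simp⟩

/-- A bound on a homogeneous part over row balls of Hilbert spaces in one universe holds over row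
balls of Hilbert spaces in every universe. -/
theorem norm_homogPart_le_of_forall {H : Type v} [NormedAddCommGroup H] [InnerProductSpace ℂ H]
    {n : ℕ} (A : FreeMonoid (Fin n) → (H →L[ℂ] H)) {r C : ℝ} (hr : 0 ≤ r) (hC : 0 ≤ C) {k : ℕ}
    (h : ∀ (X : Type u) [NormedAddCommGroup X] [InnerProductSpace ℂ X] [CompleteSpace X]
      (T : Fin n → (X →L[ℂ] X)), InClosedRowBall r T → ‖homogPart A T k‖ ≤ C)
    {K : Type w} [NormedAddCommGroup K] [InnerProductSpace ℂ K] [CompleteSpace K]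
    (T : Fin n → (K →L[ℂ] K)) (hT : InClosedRowBall r T) : ‖homogPart A T k‖ ≤ C := by
  refine HilbertTensor.opNorm_le hC fun t => ?_
  obtain ⟨S, rfl⟩ := TensorProduct.exists_finset t
  obtain ⟨d, V, hV⟩ := exists_isometry_orbit_subset_range.{u} T
    (S.finite_toSet.image Prod.fst) k
  have hV' : ∀ p ∈ S, ∀ l : List (Fin n), l.length ≤ k →
      wordOp T (FreeMonoid.ofList l) p.1 ∈ Set.range V := fun p hp =>
    hV p.1 ⟨p, hp, rfl⟩
  -- `V ⊗ id` is isometric, carries `t'` to the given tensor and intertwines the words of length at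
  -- most `k` on it; hence the bound transfers.
  set t' := ∑ p ∈ S, V.toContinuousLinearMap.adjoint p.1 ⊗ₜ[ℂ] p.2 with ht'
  have hnorm : ∀ s : EuclideanSpace ℂ (ULift.{u} (Fin d)) ⊗[ℂ] H,
      ‖TensorProduct.map V.toLinearMap LinearMap.id s‖ = ‖s‖ := fun s =>
    TensorProduct.norm_map V LinearIsometry.id s
  have hword : ∀ l : List (Fin n), l.length ≤ k → ∀ B : H →ₗ[ℂ] H,
      TensorProduct.map V.toLinearMap LinearMap.id
        (TensorProduct.map (wordOp (fun i => compression V (T i))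
          (FreeMonoid.ofList l)).toLinearMap B t') =
      TensorProduct.map (wordOp T (FreeMonoid.ofList l)).toLinearMap B
        (∑ p ∈ S, p.1 ⊗ₜ[ℂ] p.2) := by
    intro l hl B
    simp only [ht', map_sum, TensorProduct.map_tmul]
    refine Finset.sum_congr rfl fun p hp => ?_
    exact congrArg (· ⊗ₜ[ℂ] B p.2) (apply_wordOp_compression V T p.1 (hV' p hp) l hl)
  have hV1 : TensorProduct.map V.toLinearMap LinearMap.id t' = ∑ p ∈ S, p.1 ⊗ₜ[ℂ] p.2 := by
    have := hword [] (Nat.zero_le _) LinearMap.id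
    simpa [wordOp, Module.End.one_eq_id] using this
  have hle := ContinuousLinearMap.le_of_opNorm_le _
    (h _ (fun i => compression V (T i)) (hT.compression hr V)) (t' : HilbertTensor _ H)
  rw [homogPart_coe, UniformSpace.Completion.norm_coe, UniformSpace.Completion.norm_coe,
    ← hnorm, ← hnorm t', hV1, map_sum] at hle
  rw [homogPart_coe, UniformSpace.Completion.norm_coe]
  refine le_of_eq_of_le (congrArg _ (Finset.sum_congr rfl fun w _ => ?_)) hle
  exact (hword _ (List.length_ofFn).le _).symm

/-! ### Summation at radius one third -/

theorem summable_and_tsum_le_of_le_geometric_third {a : ℕ → ℝ} {α β : ℝ} (ha : ∀ k, 0 ≤ a k)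
    (hzero : a 0 ≤ α) (hpos : ∀ k, k ≠ 0 → a k ≤ 2 * β * (1 / 3) ^ k) :
    Summable a ∧ ∑' k, a k ≤ α + β := by
  have hgeom : HasSum (fun k : ℕ => 2 * β * (1 / 3 : ℝ) ^ (k + 1)) β := by
    have := (hasSum_geometric_of_lt_one (r := (1 / 3 : ℝ)) (by norm_num) (by norm_num)).mul_left
      (2 * β * (1 / 3))
    have hβ : 2 * β * (1 / 3) * (1 - 1 / 3)⁻¹ = β := by
      rw [show (1 - 1 / 3 : ℝ)⁻¹ = 3 / 2 by norm_num]
      ring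
    rw [hβ] at this
    simpa only [pow_succ', mul_assoc] using this
  have hsucc := fun k => hpos (k + 1) k.succ_ne_zero
  have hsum : Summable fun k => a (k + 1) :=
    hgeom.summable.of_nonneg_of_le (fun k => ha (k + 1)) hsucc
  have hall : Summable a := (summable_nat_add_iff 1).1 hsum
  refine ⟨hall, ?_⟩
  rw [hall.tsum_eq_zero_add]
  exact add_le_add hzero ((hsum.tsum_le_tsum hsucc hgeom.summable).trans_eq hgeom.tsum_eq)

theorem theorem2p6 {H : Type v} [NormedAddCommGroup H] [InnerProductSpace ℂ H]
    [CompleteSpace H] {n : ℕ} (A : FreeMonoid (Fin n) → (H →L[ℂ] H))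
    (hF : IsUniversalHolomorphic.{u, v} A)
    (hF_zero : ∀ (X : Type u) [NormedAddCommGroup X] [InnerProductSpace ℂ X] [CompleteSpace X],
      0 ≤ seriesValue A (0 : Fin n → (X →L[ℂ] X)))
    (hF_re : ∀ (X : Type u) [NormedAddCommGroup X] [InnerProductSpace ℂ X] [CompleteSpace X]
      (T : Fin n → (X →L[ℂ] X)), InOpenRowBall T →
        (ℜ (seriesValue A T) : HilbertTensor X H →L[ℂ] HilbertTensor X H) ≤ 1)
    {K : Type w} [NormedAddCommGroup K] [InnerProductSpace ℂ K] [CompleteSpace K]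
    (T : Fin n → (K →L[ℂ] K)) (hT : InClosedRowBall (1 / 3) T) :
    Summable (fun k : ℕ => ‖homogPart A T k‖) ∧
      ∑' k : ℕ, ‖homogPart A T k‖ ≤ ‖A 1‖ + ‖1 - A 1‖ := by
  have hzero : ‖homogPart A T 0‖ ≤ ‖A 1‖ := by
    rw [homogPart_zero]
    exact norm_opTensor_one_le _
  refine summable_and_tsum_le_of_le_geometric_third
    (fun k => ContinuousLinearMap.opNorm_nonneg _) hzero fun k hk => ?_
  exact norm_homogPart_le_of_forall.{u} A (by norm_num) (by positivity)
    (fun X _ _ _ S hS => norm_homogPart_le_of_re_le_one A hF hF_re S (by norm_num) hS hk) T hT
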